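/- Throughout, a semiring $S$ is associative with $0$ and $1$, with $0s=0=s0$ for all $s\in S$ (it may be the zero semiring). $S$ is called right (left) semisimple if the right (left) regular semimodule $S$ is a direct sum of minimal right (left) ideals, and semisimple if it is right or left semisimple (the two properties are in fact equivalent). $S$ is called a right (left) CP-semiring if every cyclic right (left) $S$-semimodule, i.e. every homomorphic image of the right (left) regular semimodule, is projective, i.e. a retract of a free semimodule. $\mathbf{B}=\{0,1\}$ denotes the Boolean semifield, in which $1+1=1$, and $M_n(\mathbf{B})$ the semiring of $n\times n$ matrices over it. **Theorem.** Let $S$ be a semisimple semiring. Then $S$ is a right CP-semiring if and only if $S\cong S_1\times\cdots\times S_r$ as semirings for some $r\ge 0$, where each $S_i$, $i=1,\dots,r$, is either an Artinian simple ring or isomorphic to $M_n(\mathbf{B})$ with $n\in\{1,2\}$ (for $r=0$ the product is the zero semiring). Likewise, $S$ is a left CP-semiring if and only if $S$ has such a decomposition. -/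

import Mathlib

universe u

/-- The Boolean semifield `𝐁 = {0, 1}`, in which `1 + 1 = 1`. -/
inductive BooleanSemifield : Type
  | zero
  | one

namespace BooleanSemifield

/-- Addition: the maximum of the two elements. -/
protected def add : BooleanSemifield → BooleanSemifield → BooleanSemifield
  | zero, b => b
  | one, _ => one

/-- Multiplication: the minimum of the two elements. -/
protected def mul : BooleanSemifield → BooleanSemifield → BooleanSemifield
  | zero, _ => zero
  | one, b => b

instance : Zero BooleanSemifield := ⟨zero⟩
instance : One BooleanSemifield := ⟨one⟩
instance : Add BooleanSemifield := ⟨BooleanSemifield.add⟩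
instance : Mul BooleanSemifield := ⟨BooleanSemifield.mul⟩

instance : CommSemiring BooleanSemifield where
  add_assoc a b c := by cases a <;> cases b <;> cases c <;> rfl
  zero_add a := by cases a <;> rfl
  add_zero a := by cases a <;> rfl
  add_comm a b := by cases a <;> cases b <;> rfl
  mul_assoc a b c := by cases a <;> cases b <;> cases c <;> rfl
  one_mul a := by cases a <;> rfl
  mul_one a := by cases a <;> rfl
  zero_mul a := by cases a <;> rfl
  mul_zero a := by cases a <;> rfl
  left_distrib a b c := by cases a <;> cases b <;> cases c <;> rfl
  right_distrib a b c := by cases a <;> cases b <;> cases c <;> rfl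
  mul_comm a b := by cases a <;> cases b <;> rfl
  nsmul := nsmulRec

end BooleanSemifield

/-- `S` is a left CP-semiring: every cyclic left `S`-semimodule, i.e. every homomorphic image of
the left regular semimodule, is projective. (Every cyclic semimodule has a copy in the universe
of `S`, being a quotient of `S`.) -/
def IsLeftCPSemiring (S : Type u) [Semiring S] : Prop :=
  ∀ (M : Type u) [AddCommMonoid M] [Module S M],
    (∃ f : S →ₗ[S] M, Function.Surjective f) → Module.Projective S M

/-- `S` is a right CP-semiring: every cyclic right `S`-semimodule is projective. Right
`S`-semimodules are semimodules over the opposite semiring `Sᵐᵒᵖ`; the right regular semimodule is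
`S` with `Sᵐᵒᵖ` acting by right multiplication. -/
def IsRightCPSemiring (S : Type u) [Semiring S] : Prop :=
  ∀ (M : Type u) [AddCommMonoid M] [Module Sᵐᵒᵖ M],
    (∃ f : S →ₗ[Sᵐᵒᵖ] M, Function.Surjective f) → Module.Projective Sᵐᵒᵖ M

open Classical in
/-- `S` is left semisimple: the left regular semimodule is the direct sum of a family of minimal
(nonzero) left ideals, i.e. each element is in exactly one way a sum of elements of these. -/
def IsLeftSemisimpleSemiring (S : Type u) [Semiring S] : Prop :=
  ∃ (ι : Type u) (I : ι → Submodule S S), (∀ i, IsAtom (I i)) ∧ DirectSum.IsInternal I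

open Classical in
/-- `S` is right semisimple: the right regular semimodule is the direct sum of a family of minimal
(nonzero) right ideals. -/
def IsRightSemisimpleSemiring (S : Type u) [Semiring S] : Prop :=
  ∃ (ι : Type u) (I : ι → Submodule Sᵐᵒᵖ S), (∀ i, IsAtom (I i)) ∧ DirectSum.IsInternal I

/-- The semiring `T` is an Artinian simple ring. -/
def IsArtinianSimpleRing (T : Type u) [Semiring T] : Prop :=
  ∃ (R : Type u) (_ : Ring R), IsSimpleRing R ∧ IsArtinianRing R ∧ Nonempty (T ≃+* R)

/-- `S` is isomorphic to a finite product `S₁ × ⋯ × Sᵣ` of semirings each of which is an Artinian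
simple ring or isomorphic to `M₁(𝐁)` or `M₂(𝐁)`. The empty product is the zero semiring. -/
def IsProductOfArtinianSimpleOrBooleanMatrix (S : Type u) [Semiring S] : Prop :=
  ∃ (r : ℕ) (T : Fin r → Type u) (_ : ∀ i, Semiring (T i)),
    (∀ i, IsArtinianSimpleRing (T i) ∨
      ∃ n : ℕ, (n = 1 ∨ n = 2) ∧
        Nonempty (T i ≃+* Matrix (Fin n) (Fin n) BooleanSemifield)) ∧
    Nonempty (S ≃+* ((i : Fin r) → T i))

/-! Semisimplicity makes `S` a finite product of matrix semirings over division semirings: the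
simple summands of `S` are projective, so Schur's lemma survives, and Wedderburn–Artin follows
through endomorphisms. The CP property passes to quotients and finite products, so a single `Mₙ(D)`
has to be decided. If some nonzero element of `D` has an additive inverse, `D` is a division ring
and `Mₙ(D)` is Artinian simple; all modules over it are projective. Otherwise `D` is zerosumfree.
The congruence "same zero pattern" then forces `D = 𝐁`, and for `n ≥ 3` a cyclic semimodule built on
the nondistributive lattice `M₃` is not projective. For `n ≤ 2` only chains and `𝐁²` occur as
quotients of `𝐁ⁿ`, and these are retracts. The right-hand case is the left-hand one for `Sᵐᵒᵖ`. -/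

/-! ### The CP property in terms of congruences -/

/-- A section of `S → S/c` is determined by the image `p` of the class of `1`: it sends the class of
`x` to `x * p`. Since no module is mentioned, this form also moves between universes. -/
theorem isLeftCPSemiring_iff_forall_moduleCon {S : Type u} [Semiring S] :
    IsLeftCPSemiring S ↔ ∀ c : ModuleCon S S,
      ∃ p, c.toAddCon p 1 ∧ ∀ x y, c.toAddCon x y → x * p = y * p := by
  constructor
  · intro h c
    let f : S →ₗ[S] c.Quotient :=
      { toFun := fun x => (Quotient.mk'' x : Quotient c.toSetoid)
        map_add' := fun _ _ => rfl
        map_smul' := fun _ _ => rfl }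
    have hf : Function.Surjective f := Quotient.mk''_surjective
    have := h c.Quotient ⟨f, hf⟩
    obtain ⟨g, hg⟩ := Module.projective_lifting_property f LinearMap.id hf
    refine ⟨g (f 1), ?_, fun x y hxy => ?_⟩
    · exact Quotient.exact (LinearMap.congr_fun hg (f 1))
    · have key : ∀ x, x * g (f 1) = g (f x) := fun x => by
        rw [← smul_eq_mul, ← map_smul, ← map_smul, smul_eq_mul, mul_one]
      rw [key, key]
      exact congrArg g (Quotient.sound hxy)
  · rintro h M _ _ ⟨f, hf⟩
    obtain ⟨p, hp, hxy⟩ := h (ModuleCon.ker f.toDistribMulActionHom)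
    have hp : f p = f 1 := hp
    have hxy : ∀ x y, f x = f y → x * p = y * p := hxy
    let g : M →ₗ[S] S :=
      { toFun := fun m => (hf m).choose * p
        map_add' := fun m n => by
          rw [← add_mul]
          exact hxy _ _ (by
            rw [map_add, (hf (m + n)).choose_spec, (hf m).choose_spec, (hf n).choose_spec])
        map_smul' := fun s m => by
          rw [RingHom.id_apply, smul_eq_mul, ← mul_assoc]
          exact hxy _ _ (by
            rw [← smul_eq_mul, map_smul, (hf (s • m)).choose_spec, (hf m).choose_spec]) }
    refine Module.Projective.of_split g f (LinearMap.ext fun m => ?_)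
    change f ((hf m).choose * p) = m
    rw [← smul_eq_mul, map_smul, hp, ← map_smul, smul_eq_mul, mul_one, (hf m).choose_spec]

theorem IsLeftCPSemiring.of_surjective {S : Type*} {T : Type*} [Semiring S] [Semiring T]
    (h : IsLeftCPSemiring S) (π : S →+* T) (hπ : Function.Surjective π) : IsLeftCPSemiring T := by
  rw [isLeftCPSemiring_iff_forall_moduleCon] at h ⊢
  intro c
  obtain ⟨p, hp, hxy⟩ := h
    { toSetoid := c.toSetoid.comap π
      add' := fun {w x y z} h₁ h₂ => by
        change c.toAddCon (π (w + y)) (π (x + z))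
        rw [map_add π, map_add π]
        exact c.toAddCon.add h₁ h₂
      smul := fun s {x y} h => by
        change c.toAddCon (π (s * x)) (π (s * y))
        rw [map_mul π, map_mul π]
        exact c.smul (π s) h }
  refine ⟨π p, ?_, fun x y h => ?_⟩
  · have hp : c.toAddCon (π p) (π 1) := hp
    rwa [map_one] at hp
  · obtain ⟨x, rfl⟩ := hπ x
    obtain ⟨y, rfl⟩ := hπ y
    rw [← map_mul, ← map_mul, hxy x y h]

theorem IsLeftCPSemiring.pi {ι : Type*} [Finite ι] {T : ι → Type*} [∀ i, Semiring (T i)]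
    (h : ∀ i, IsLeftCPSemiring (T i)) : IsLeftCPSemiring (∀ i, T i) := by
  classical
  have := Fintype.ofFinite ι
  simp only [isLeftCPSemiring_iff_forall_moduleCon] at h ⊢
  intro c
  have key : ∀ i, ∃ p : T i, c.toAddCon (Pi.single i p) (Pi.single i 1) ∧
      ∀ x y, c.toAddCon (Pi.single i x) (Pi.single i y) → x * p = y * p := fun i =>
    h i
      { toSetoid := c.toSetoid.comap (Pi.single i)
        add' := fun {w x y z} h₁ h₂ => by
          change c.toAddCon (Pi.single i (w + y)) (Pi.single i (x + z))
          rw [Pi.single_add, Pi.single_add]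
          exact c.toAddCon.add h₁ h₂
        smul := fun s {x y} h => by
          change c.toAddCon (Pi.single i (s * x)) (Pi.single i (s * y))
          rw [Pi.single_mul, Pi.single_mul]
          exact c.smul (Pi.single i s) h }
  choose p hp hxy using key
  refine ⟨p, ?_, fun x y h => funext fun i => hxy i _ _ ?_⟩
  · rw [← Finset.univ_sum_single p, ← Finset.univ_sum_single (1 : ∀ i, T i)]
    exact c.toAddCon.finsetSum _ fun i _ => hp i
  -- Multiplying by the idempotent `Pi.single i 1` cuts the relation down to the `i`-th factor.
  · have := c.smul (Pi.single i 1) h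
    have e : ∀ z : ∀ i, T i, (Pi.single i 1 : ∀ i, T i) • z = Pi.single i (z i) := fun z => by
      ext j
      obtain rfl | hj := eq_or_ne j i <;> simp [*]
    rw [e, e] at this
    exact this

theorem IsArtinianSimpleRing.isLeftCPSemiring {T : Type u} [Semiring T]
    (h : IsArtinianSimpleRing T) : IsLeftCPSemiring T := by
  obtain ⟨R, _, _, _, ⟨e⟩⟩ := h
  refine IsLeftCPSemiring.of_surjective (S := R) ?_ e.symm.toRingHom e.symm.surjective
  intro M _ _ _
  -- Over a ring every semimodule is a group, with `-m = (-1) • m`.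
  let := Module.addCommMonoidToAddCommGroup R (M := M)
  exact Module.projective_of_isSemisimpleRing R M

theorem isRightCPSemiring_iff_isLeftCPSemiring_op {S : Type u} [Semiring S] :
    IsRightCPSemiring S ↔ IsLeftCPSemiring Sᵐᵒᵖ := by
  let e : S ≃ₗ[Sᵐᵒᵖ] Sᵐᵒᵖ :=
    { MulOpposite.opAddEquiv with map_smul' := fun _ _ => rfl }
  refine forall_congr' fun M => forall_congr' fun _ => forall_congr' fun _ => ?_
  refine imp_congr ⟨?_, ?_⟩ Iff.rfl
  · rintro ⟨f, hf⟩
    exact ⟨f ∘ₗ e.symm.toLinearMap, hf.comp e.symm.surjective⟩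
  · rintro ⟨f, hf⟩
    exact ⟨f ∘ₗ e.toLinearMap, hf.comp e.surjective⟩

/-! ### Schur's lemma and Wedderburn–Artin for semisimple semirings -/

open Module

section Schur

variable {R M N : Type*} [Semiring R] [AddCommMonoid M] [Module R M] [AddCommMonoid N] [Module R N]

theorem LinearMap.surjective_of_ne_zero_of_isSimpleOrder [IsSimpleOrder (Submodule R N)]
    {f : M →ₗ[R] N} (hf : f ≠ 0) : Function.Surjective f := by
  rw [← LinearMap.range_eq_top]
  exact (eq_bot_or_eq_top _).resolve_left fun h => hf (LinearMap.range_eq_bot.1 h)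

/-- Schur's lemma for projective simple semimodules. -/
theorem LinearMap.bijective_of_ne_zero_of_isSimpleOrder [IsSimpleOrder (Submodule R M)]
    [IsSimpleOrder (Submodule R N)] [Module.Projective R N]
    {f : M →ₗ[R] N} (hf : f ≠ 0) : Function.Bijective f := by
  have hs := surjective_of_ne_zero_of_isSimpleOrder hf
  -- A zero kernel would not give injectivity over a semiring. Instead, a section `g` of `f` is
  -- nonzero, hence onto by simplicity of `M`, and `f` is injective on the range of `g`.
  obtain ⟨g, hg⟩ := Module.projective_lifting_property f LinearMap.id hs
  have hg0 : g ≠ 0 := by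
    rintro rfl
    rw [LinearMap.comp_zero] at hg
    exact hf (by rw [← LinearMap.id_comp f, ← hg, LinearMap.zero_comp])
  have hgs := surjective_of_ne_zero_of_isSimpleOrder hg0
  refine ⟨fun x y hxy => ?_, hs⟩
  obtain ⟨x, rfl⟩ := hgs x
  obtain ⟨y, rfl⟩ := hgs y
  have key : ∀ z, f (g z) = z := LinearMap.congr_fun hg
  rw [key, key] at hxy
  rw [hxy]

theorem Module.End.isUnit_of_ne_zero_of_isSimpleOrder [IsSimpleOrder (Submodule R M)]
    [Module.Projective R M] {f : Module.End R M} (hf : f ≠ 0) : IsUnit f :=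
  (Module.End.isUnit_iff f).2 (LinearMap.bijective_of_ne_zero_of_isSimpleOrder hf)

end Schur

/-- The endomorphism semiring of a finite product of semimodules without nonzero homomorphisms
between different factors. -/
def Module.End.piRingEquivOfHomEqZero {R ι : Type*} [Semiring R] [Fintype ι] [DecidableEq ι]
    (N : ι → Type*) [∀ i, AddCommMonoid (N i)] [∀ i, Module R (N i)]
    (h : ∀ i j, i ≠ j → ∀ f : N i →ₗ[R] N j, f = 0) :
    Module.End R (∀ i, N i) ≃+* ∀ i, Module.End R (N i) where
  toFun f i := LinearMap.proj i ∘ₗ f ∘ₗ LinearMap.single R N i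
  invFun g := LinearMap.pi fun i => g i ∘ₗ LinearMap.proj i
  left_inv f := by
    refine LinearMap.pi_ext' fun i => LinearMap.ext fun x => funext fun j => ?_
    obtain rfl | hij := eq_or_ne i j
    · simp
    · have : f (Pi.single i x) j = 0 :=
        LinearMap.congr_fun (h i j hij (LinearMap.proj j ∘ₗ f ∘ₗ LinearMap.single R N i)) x
      simp [this, Pi.single_eq_of_ne' hij]
  right_inv g := by ext i x; simp
  map_add' f g := by ext i x; simp
  map_mul' f g := by
    refine funext fun i => LinearMap.ext fun x => ?_
    have key : g (Pi.single i x) = Pi.single i (g (Pi.single i x) i) := by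
      funext j
      obtain rfl | hij := eq_or_ne i j
      · simp
      · have : g (Pi.single i x) j = 0 :=
          LinearMap.congr_fun (h i j hij (LinearMap.proj j ∘ₗ g ∘ₗ LinearMap.single R N i)) x
        rw [this, Pi.single_eq_of_ne' hij]
    change f (g (Pi.single i x)) i = f (Pi.single i (g (Pi.single i x) i)) i
    rw [← key]

/-- Finitely many generators involve only finitely many summands. -/
theorem DirectSum.IsInternal.finite_of_module_finite {R M ι : Type*} [Semiring R] [AddCommMonoid M]
    [Module R M] [Module.Finite R M] [DecidableEq ι] {I : ι → Submodule R M}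
    (hI : ∀ i, I i ≠ ⊥) (h : DirectSum.IsInternal I) : Finite ι := by
  classical
  let e : DirectSum ι (fun i => I i) ≃ₗ[R] M := LinearEquiv.ofBijective (DirectSum.coeLinearMap I) h
  obtain ⟨t, ht⟩ := Module.Finite.fg_top (R := R) (M := M)
  let F : Finset ι := t.biUnion fun x => DFinsupp.support (e.symm x)
  have hF : ∀ x : M, ∀ i ∉ F, e.symm x i = 0 := by
    intro x i hi
    have hx : x ∈ Submodule.span R (t : Set M) := ht ▸ Submodule.mem_top
    induction hx using Submodule.span_induction with
    | mem y hy =>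
      by_contra h0
      exact hi (Finset.mem_biUnion.2 ⟨y, hy, DFinsupp.mem_support_iff.2 h0⟩)
    | zero => rw [map_zero]; rfl
    | add y z _ _ hy hz => rw [map_add, DirectSum.add_apply, hy, hz, add_zero]
    | smul r y _ hy => rw [map_smul, DirectSum.smul_apply, hy, smul_zero]
  refine Finite.of_surjective (fun i : F => (i : ι)) fun i => ⟨⟨i, ?_⟩, rfl⟩
  by_contra hi
  refine hI i ((Submodule.eq_bot_iff _).2 fun x hx => ?_)
  have := hF (e (DirectSum.lof R ι (fun i => I i) i ⟨x, hx⟩)) i hi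
  rw [LinearEquiv.symm_apply_apply, DirectSum.lof_apply] at this
  exact congrArg Subtype.val this

/-- A finite product, regrouped along a map of the index set. -/
def LinearEquiv.piFiber {R ι κ : Type*} [Semiring R] (q : ι → κ) {N : ι → Type*} {J : κ → Type*}
    [∀ i, AddCommMonoid (N i)] [∀ i, Module R (N i)]
    [∀ c, AddCommMonoid (J c)] [∀ c, Module R (J c)] (e : ∀ i, N i ≃ₗ[R] J (q i)) :
    (∀ i, N i) ≃ₗ[R] ∀ c, {i // q i = c} → J c where
  toFun x c i := i.2 ▸ e i (x i)
  invFun y i := (e i).symm (y (q i) ⟨i, rfl⟩)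
  left_inv x := by ext; simp
  right_inv y := by ext c ⟨i, rfl⟩; simp
  map_add' x y := by ext c ⟨i, rfl⟩; simp
  map_smul' r x := by ext c ⟨i, rfl⟩; simp

/-- The Wedderburn–Artin theorem for endomorphisms of a finitely generated projective semimodule
that is a direct sum of minimal subsemimodules. -/
theorem DirectSum.IsInternal.exists_end_ringEquiv_pi_matrix {R : Type*} {M ι : Type u} [Semiring R]
    [AddCommMonoid M] [Module R M] [Module.Finite R M] [Module.Projective R M] [DecidableEq ι]
    {I : ι → Submodule R M} (hI : ∀ i, IsAtom (I i)) (h : DirectSum.IsInternal I) :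
    ∃ (r : ℕ) (n : Fin r → ℕ) (D : Fin r → Type u) (_ : ∀ c, Semiring (D c)),
      (∀ c, n c ≠ 0) ∧ (∀ c, Nontrivial (D c)) ∧ (∀ c (a : D c), a ≠ 0 → IsUnit a) ∧
        Nonempty (Module.End R M ≃+* ∀ c, Matrix (Fin (n c)) (Fin (n c)) (D c)) := by
  classical
  have := h.finite_of_module_finite fun i => (hI i).1
  have := Fintype.ofFinite ι
  let e₁ : DirectSum ι (fun i => I i) ≃ₗ[R] M :=
    LinearEquiv.ofBijective (DirectSum.coeLinearMap I) h
  have hproj : ∀ i, Module.Projective R (I i) :=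
    Module.Projective.directSum_iff.1 (Module.Projective.of_equiv' e₁.symm)
  have hsimple : ∀ i, IsSimpleOrder (Submodule R (I i)) := fun i =>
    have := Set.isSimpleOrder_Iic_iff_isAtom.2 (hI i)
    (Submodule.mapIic (I i)).isSimpleOrder
  -- Isotypic classes: each class yields one matrix factor, over the endomorphisms of a
  -- representative.
  let s : Setoid ι :=
    { r := fun i j => Nonempty (I i ≃ₗ[R] I j)
      iseqv := ⟨fun i => ⟨.refl R _⟩, fun ⟨e⟩ => ⟨e.symm⟩, fun ⟨e⟩ ⟨f⟩ => ⟨e.trans f⟩⟩ }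
  let σ := Finite.equivFin (Quotient s)
  let q : ι → Fin (Nat.card (Quotient s)) := fun i => σ ⟦i⟧
  let o : Fin (Nat.card (Quotient s)) → ι := fun c => (σ.symm c).out
  have hqo : ∀ c, q (o c) = c := fun c => by simp [q, o]
  have hq : ∀ i, Nonempty (I i ≃ₗ[R] I (o (q i))) := fun i =>
    s.symm (Quotient.exact (by simp [q, o]))
  have hhom : ∀ c d, c ≠ d → ∀ f : I (o c) →ₗ[R] I (o d), f = 0 := by
    intro c d hcd f
    by_contra hf
    have : (⟦o c⟧ : Quotient s) = ⟦o d⟧ := Quotient.sound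
      ⟨LinearEquiv.ofBijective f (LinearMap.bijective_of_ne_zero_of_isSimpleOrder hf)⟩
    apply hcd
    rw [← hqo c, ← hqo d]
    exact congrArg σ this
  let e₂ : M ≃ₗ[R] ∀ c, {i // q i = c} → I (o c) :=
    (e₁.symm.trans (DirectSum.linearEquivFunOnFintype R ι fun i => I i)).trans
      (LinearEquiv.piFiber q fun i => (hq i).some)
  have hhom' : ∀ c d, c ≠ d →
      ∀ f : ({i // q i = c} → I (o c)) →ₗ[R] ({i // q i = d} → I (o d)), f = 0 := by
    intro c d hcd f
    refine LinearMap.pi_ext' fun i => LinearMap.ext fun x => funext fun j => ?_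
    exact LinearMap.congr_fun (hhom c d hcd
      (LinearMap.proj j ∘ₗ f ∘ₗ LinearMap.single R (fun _ => I (o c)) i)) x
  let E := (e₂.conjRingEquiv.trans (Module.End.piRingEquivOfHomEqZero _ hhom')).trans
    (RingEquiv.piCongrRight fun c =>
      ((LinearEquiv.funCongrLeft R (I (o c)) (Finite.equivFin {i // q i = c}).symm).conjRingEquiv).trans
        (endVecRingEquivMatrixEnd _ R (I (o c))))
  refine ⟨_, _, fun c => Module.End R (I (o c)), inferInstance, fun c => ?_, fun c => ?_,
    fun c a ha => Module.End.isUnit_of_ne_zero_of_isSimpleOrder ha, ⟨E⟩⟩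
  · have : Nonempty {i // q i = c} := ⟨⟨o c, hqo c⟩⟩
    exact Nat.card_pos.ne'
  · obtain ⟨x, hx, h0⟩ := (Submodule.ne_bot_iff _).1 (hI (o c)).1
    refine ⟨1, 0, fun h10 => h0 ?_⟩
    exact congrArg Subtype.val (LinearMap.congr_fun h10 ⟨x, hx⟩)

/-- `S` is a finite product of matrix semirings over division semirings. -/
def IsProductOfMatrixDivisionSemiring (S : Type u) [Semiring S] : Prop :=
  ∃ (r : ℕ) (n : Fin r → ℕ) (D : Fin r → Type u) (_ : ∀ c, Semiring (D c)),
    (∀ c, n c ≠ 0) ∧ (∀ c, Nontrivial (D c)) ∧ (∀ c (a : D c), a ≠ 0 → IsUnit a) ∧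
      Nonempty (S ≃+* ∀ c, Matrix (Fin (n c)) (Fin (n c)) (D c))

theorem IsProductOfMatrixDivisionSemiring.of_op {S : Type u} [Semiring S]
    (h : IsProductOfMatrixDivisionSemiring Sᵐᵒᵖ) : IsProductOfMatrixDivisionSemiring S := by
  obtain ⟨r, n, D, _, hn, _, hD, ⟨e⟩⟩ := h
  refine ⟨r, n, fun c => (D c)ᵐᵒᵖ, inferInstance, hn, fun c => inferInstance, fun c a ha => ?_, ⟨?_⟩⟩
  · exact (hD c a.unop (MulOpposite.unop_ne_zero_iff _ |>.2 ha)).op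
  · exact (RingEquiv.opOp S).trans (e.op.trans ((RingEquiv.piMulOpposite _).trans
      (RingEquiv.piCongrRight fun c => RingEquiv.mopMatrix.symm)))

theorem IsLeftSemisimpleSemiring.isProductOfMatrixDivisionSemiring {S : Type u} [Semiring S]
    (h : IsLeftSemisimpleSemiring S) : IsProductOfMatrixDivisionSemiring S := by
  classical
  obtain ⟨ι, I, hI, hS⟩ := h
  obtain ⟨r, n, D, _, hn, hD, hu, ⟨e⟩⟩ := hS.exists_end_ringEquiv_pi_matrix hI
  -- Endomorphisms of the left regular semimodule are right multiplications, which compose in the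
  -- opposite order.
  exact .of_op ⟨r, n, D, _, hn, hD, hu, ⟨(RingEquiv.moduleEndSelf S).trans e⟩⟩

theorem IsRightSemisimpleSemiring.isProductOfMatrixDivisionSemiring {S : Type u} [Semiring S]
    (h : IsRightSemisimpleSemiring S) : IsProductOfMatrixDivisionSemiring S := by
  classical
  obtain ⟨ι, I, hI, hS⟩ := h
  let e : Sᵐᵒᵖ ≃ₗ[Sᵐᵒᵖ] S :=
    { MulOpposite.opAddEquiv.symm with map_smul' := fun _ _ => rfl }
  have : Module.Finite Sᵐᵒᵖ S := .equiv e
  have : Module.Projective Sᵐᵒᵖ S := .of_equiv' e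
  obtain ⟨r, n, D, _, hn, hD, hu, ⟨E⟩⟩ := hS.exists_end_ringEquiv_pi_matrix hI
  exact ⟨r, n, D, _, hn, hD, hu, ⟨(RingEquiv.moduleEndSelfOp S).trans E⟩⟩

/-! ### Obstructions over zerosumfree semirings -/

section Zerosumfree

variable {D : Type*} [Semiring D]

theorem Finset.sum_eq_zero_iff_of_zerosumfree (hz : ∀ a b : D, a + b = 0 → a = 0) {ι : Type*}
    (s : Finset ι) (f : ι → D) : ∑ i ∈ s, f i = 0 ↔ ∀ i ∈ s, f i = 0 := by
  classical
  refine ⟨fun h i hi => ?_, Finset.sum_eq_zero⟩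
  rw [← Finset.add_sum_erase s f hi] at h
  exact hz _ _ h

/-- The only nonzero element of a zerosumfree division semiring `D` is `1`, if `Mₘ(D)` is a left
CP-semiring. -/
theorem IsLeftCPSemiring.eq_one_of_ne_zero {m : Type*} [Fintype m] [DecidableEq m] [Nonempty m]
    (hz : ∀ a b : D, a + b = 0 → a = 0) (hu : ∀ a : D, a ≠ 0 → IsUnit a)
    (h : IsLeftCPSemiring (Matrix m m D)) {d : D} (hd : d ≠ 0) : d = 1 := by
  have hz' : ∀ a b : D, a + b = 0 ↔ a = 0 ∧ b = 0 := fun a b =>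
    ⟨fun h => ⟨hz a b h, hz b a (by rwa [add_comm])⟩, by rintro ⟨rfl, rfl⟩; exact add_zero 0⟩
  have hmul : ∀ a b : D, a * b = 0 ↔ a = 0 ∨ b = 0 := fun a b => by
    refine ⟨fun hab => or_iff_not_imp_left.2 fun ha => (hu a ha).mul_right_eq_zero.1 hab, ?_⟩
    rintro (rfl | rfl) <;> simp
  rw [isLeftCPSemiring_iff_forall_moduleCon] at h
  -- The congruence "same zero pattern": zerosumfreeness and the absence of zero divisors make it
  -- compatible with both operations.
  obtain ⟨p, hp, hxy⟩ := h
    { r := fun A B => ∀ i j, A i j = 0 ↔ B i j = 0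
      iseqv := ⟨fun _ _ _ => Iff.rfl, fun h i j => (h i j).symm,
        fun h₁ h₂ i j => (h₁ i j).trans (h₂ i j)⟩
      add' := fun h₁ h₂ i j => by
        simp only [Matrix.add_apply, hz']
        exact and_congr (h₁ i j) (h₂ i j)
      smul := fun C {A B} h i j => by
        simp only [smul_eq_mul, Matrix.mul_apply, Finset.sum_eq_zero_iff_of_zerosumfree hz, hmul, h] }
  have hp : ∀ i j, p i j = 0 ↔ (1 : Matrix m m D) i j = 0 := hp
  obtain ⟨i⟩ := ‹Nonempty m›
  have h1 : (1 : D) ≠ 0 := fun h => hd (by rw [← one_mul d, h, zero_mul])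
  have hpi : p i i ≠ 0 := fun h => h1 (by simpa using (hp i i).1 h)
  -- The scalar matrices `d` and `1` are congruent, so `d * p i i = p i i`, and the unit `p i i`
  -- cancels.
  have key := hxy (Matrix.diagonal fun _ => d) 1 fun i j => by
    obtain rfl | hij := eq_or_ne i j
    · simp [hd, h1]
    · simp [hij]
  have := congrFun (congrFun key i) i
  rw [Matrix.diagonal_mul, one_mul] at this
  exact (hu _ hpi).mul_right_cancel (this.trans (one_mul _).symm)

/-- A zerosumfree idempotent semiring has no matrix semirings of size at least three that are left
CP-semirings. -/
theorem not_isLeftCPSemiring_matrix_of_ne {m : Type*} [Fintype m] [DecidableEq m]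
    (h01 : (0 : D) ≠ 1) (hz : ∀ a b : D, a + b = 0 → a = 0) (h11 : (1 : D) + 1 = 1)
    {a b c : m} (hab : a ≠ b) (hac : a ≠ c) (hbc : b ≠ c) :
    ¬ IsLeftCPSemiring (Matrix m m D) := by
  rw [isLeftCPSemiring_iff_forall_moduleCon]
  intro h
  -- On `{a, b, c}`, `u` has zero diagonal and ones elsewhere. Any two of its three nonzero rows
  -- have the same sum; over `𝐁` they span the lattice `M₃`. The congruence below is the kernel of
  -- right multiplication by `u`.
  let u : Matrix m m D := fun i j =>
    if (i = a ∨ i = b ∨ i = c) ∧ (j = a ∨ j = b ∨ j = c) ∧ i ≠ j then 1 else 0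
  obtain ⟨p, hp, hxy⟩ := h
    { r := fun A B => A * u = B * u
      iseqv := ⟨fun _ => rfl, Eq.symm, Eq.trans⟩
      add' := fun {A B A' B'} h₁ h₂ => by
        change (A + A') * u = (B + B') * u
        rw [add_mul, add_mul, show A * u = B * u from h₁, show A' * u = B' * u from h₂]
      smul := fun C {A B} h => by
        change C * A * u = C * B * u
        rw [mul_assoc, mul_assoc, show A * u = B * u from h] }
  have hp : p * u = u := (show p * u = 1 * u from hp).trans (one_mul u)
  -- The zero diagonal of `p * u = u` kills the off-diagonal entries of `p` within `{a, b, c}`,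
  -- while `u b a = 1` keeps `p b b` nonzero.
  have hterm : ∀ i j, u i j = 0 → ∀ k, p i k * u k j = 0 := fun i j hij k => by
    rw [← hp, Matrix.mul_apply, Finset.sum_eq_zero_iff_of_zerosumfree hz] at hij
    exact hij k (Finset.mem_univ k)
  have hpab : p a b = 0 := by simpa [u, hab.symm] using hterm a a (by simp [u]) b
  have hpcb : p c b = 0 := by simpa [u, hbc] using hterm c c (by simp [u]) b
  have hpbc : p b c = 0 := by simpa [u, hbc.symm] using hterm b b (by simp [u]) c
  have hpbb : p b b ≠ 0 := fun hpbb => by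
    have hba := congrFun (congrFun hp b) a
    rw [Matrix.mul_apply, Finset.sum_eq_zero fun k _ => ?_] at hba
    · exact h01 (by simpa [u, hab.symm] using hba)
    · by_cases hkb : k = b
      · rw [hkb, hpbb, zero_mul]
      by_cases hkc : k = c
      · rw [hkc, hpbc, zero_mul]
      · simp [u, hkb, hkc]
  -- Rows `a + b` and `a + c` of `u` agree, so those of `p` must agree too; column `b` then gives `p
  -- b b = 0`.
  have key := hxy (Matrix.single a a 1 + Matrix.single a b 1)
    (Matrix.single a a 1 + Matrix.single a c 1) (by
      change (_ + _) * u = (_ + _) * u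
      ext i j
      simp only [add_mul, Matrix.add_apply]
      obtain rfl | hi := eq_or_ne i a
      · simp only [Matrix.single_mul_apply_same, one_mul]
        by_cases hja : j = i
        · simp [u, hja, hab.symm, hac.symm]
        by_cases hjb : j = b
        · simp [u, hjb, hab, hbc.symm, h11]
        by_cases hjc : j = c
        · simp [u, hjc, hac, hbc, h11]
        · simp [u, hja, hjb, hjc]
      · simp [Matrix.single_mul_apply_of_ne, hi])
  have := congrFun (congrFun key a) b
  simp only [add_mul, Matrix.add_apply, Matrix.single_mul_apply_same, one_mul, hpab, hpcb,
    zero_add] at this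
  exact hpbb this

end Zerosumfree

/-! ### Matrices of size one and two over the Boolean semifield -/

theorem BooleanSemifield.nonempty_ringEquiv {D : Type*} [Semiring D] (h01 : (0 : D) ≠ 1)
    (h11 : (1 : D) + 1 = 1) (h : ∀ d : D, d ≠ 0 → d = 1) : Nonempty (D ≃+* BooleanSemifield) := by
  let f : BooleanSemifield →+* D :=
    { toFun := fun x => BooleanSemifield.casesOn x 0 1
      map_zero' := rfl
      map_one' := rfl
      map_add' := by rintro ⟨⟩ ⟨⟩ <;> first | exact (zero_add _).symm | exact (add_zero _).symm | exact h11.symm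
      map_mul' := by rintro ⟨⟩ ⟨⟩ <;> first | exact (zero_mul _).symm | exact (one_mul _).symm }
  refine ⟨(RingEquiv.ofBijective f ⟨?_, fun d => ?_⟩).symm⟩
  · rintro ⟨⟩ ⟨⟩ hxy
    · rfl
    · exact absurd hxy h01
    · exact absurd hxy h01.symm
    · rfl
  · by_cases hd : d = 0
    · exact ⟨.zero, hd.symm⟩
    · exact ⟨.one, (h d hd).symm⟩

theorem BooleanSemifield.isLeftCPSemiring : IsLeftCPSemiring BooleanSemifield := by
  rw [isLeftCPSemiring_iff_forall_moduleCon]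
  intro c
  by_cases h : c.toAddCon 0 1
  · exact ⟨0, h, fun x y _ => by rw [mul_zero, mul_zero]⟩
  · refine ⟨1, c.toAddCon.refl 1, ?_⟩
    rintro ⟨⟩ ⟨⟩ hxy
    · rfl
    · exact absurd hxy h
    · exact absurd (c.toAddCon.symm hxy) h
    · rfl

/-- Every quotient of the Boolean semimodule `𝐁²` is a retract. -/
theorem BooleanSemifield.exists_retraction_of_addCon_prod
    (c : AddCon (BooleanSemifield × BooleanSemifield)) :
    ∃ p q : BooleanSemifield × BooleanSemifield, c p (1, 0) ∧ c q (0, 1) ∧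
      ∀ v w, c v w → v.1 • p + v.2 • q = w.1 • p + w.2 • q := by
  have hs : ∀ {v w}, c v w → c w v := c.symm
  have ht : ∀ {u v w}, c u v → c v w → c u w := c.trans
  have hx : ∀ {v w}, c v w → c ((1, 0) + v) ((1, 0) + w) := c.add (c.refl _)
  have hy : ∀ {v w}, c v w → c ((0, 1) + v) ((0, 1) + w) := c.add (c.refl _)
  -- With `x = (1, 0)`, `y = (0, 1)`, `t = (1, 1)`, the quotient is a chain of at most three
  -- elements or `𝐁²` itself. In each case `p` and `q` represent the classes of `x` and `y` so that
  -- the induced map is constant on classes.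
  by_cases h0x : c (.zero, .zero) (.one, .zero)
  · by_cases h0y : c (.zero, .zero) (.zero, .one)
    · exact ⟨0, 0, h0x, h0y, fun v w _ => by simp only [smul_zero]⟩
    · have hyt : c (.zero, .one) (.one, .one) := hy h0x
      refine ⟨0, (0, 1), h0x, c.refl _, ?_⟩
      rintro ⟨⟨⟩, ⟨⟩⟩ ⟨⟨⟩, ⟨⟩⟩ h <;> first | rfl | (exfalso; grind)
  · by_cases h0y : c (.zero, .zero) (.zero, .one)
    · have hxt : c (.one, .zero) (.one, .one) := hx h0y
      refine ⟨(1, 0), 0, c.refl _, h0y, ?_⟩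
      rintro ⟨⟨⟩, ⟨⟩⟩ ⟨⟨⟩, ⟨⟩⟩ h <;> first | rfl | (exfalso; grind)
    · have h0t : ¬ c (.zero, .zero) (.one, .one) := fun h => h0x (ht h (hs (hx h)))
      by_cases hxt : c (.one, .zero) (.one, .one)
      · by_cases hyt : c (.zero, .one) (.one, .one)
        · refine ⟨(1, 1), (1, 1), hs hxt, hs hyt, ?_⟩
          rintro ⟨⟨⟩, ⟨⟩⟩ ⟨⟨⟩, ⟨⟩⟩ h <;> first | rfl | (exfalso; grind)
        · have hxy : ¬ c (.one, .zero) (.zero, .one) := fun h => hyt (hs (hy h))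
          refine ⟨(1, 1), (0, 1), hs hxt, c.refl _, ?_⟩
          rintro ⟨⟨⟩, ⟨⟩⟩ ⟨⟨⟩, ⟨⟩⟩ h <;> first | rfl | (exfalso; grind)
      · have hxy : ¬ c (.one, .zero) (.zero, .one) := fun h => hxt (hx h)
        by_cases hyt : c (.zero, .one) (.one, .one)
        · refine ⟨(1, 0), (1, 1), c.refl _, hs hyt, ?_⟩
          rintro ⟨⟨⟩, ⟨⟩⟩ ⟨⟨⟩, ⟨⟩⟩ h <;> first | rfl | (exfalso; grind)
        · refine ⟨(1, 0), (0, 1), c.refl _, c.refl _, ?_⟩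
          rintro ⟨⟨⟩, ⟨⟩⟩ ⟨⟨⟩, ⟨⟩⟩ h <;> first | rfl | (exfalso; grind)

/-- Matrix units move rows around, so a left congruence is determined by its restriction to first
rows, a congruence on `𝐁²`. The retraction found there supplies the two rows of the required matrix.
-/
theorem BooleanSemifield.isLeftCPSemiring_matrix_two :
    IsLeftCPSemiring (Matrix (Fin 2) (Fin 2) BooleanSemifield) := by
  rw [isLeftCPSemiring_iff_forall_moduleCon]
  intro c
  let ρ : BooleanSemifield × BooleanSemifield →+ Matrix (Fin 2) (Fin 2) BooleanSemifield :=
    { toFun := fun v => !![v.1, v.2; 0, 0]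
      map_zero' := by ext i j; fin_cases i <;> fin_cases j <;> rfl
      map_add' := fun v w => by ext i j; fin_cases i <;> fin_cases j <;> rfl }
  obtain ⟨p, q, hp, hq, hpq⟩ := exists_retraction_of_addCon_prod (c.toAddCon.comap ρ (map_add ρ))
  have hp : c.toAddCon (ρ p) (ρ (1, 0)) := hp
  have hq : c.toAddCon (ρ q) (ρ (0, 1)) := hq
  refine ⟨!![p.1, p.2; q.1, q.2], ?_, fun A B h => ?_⟩
  · have := c.toAddCon.add (c.smul !![1, 0; 0, 0] hp) (c.smul !![0, 0; 1, 0] hq)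
    convert this using 1 <;> ext i j <;> fin_cases i <;> fin_cases j <;>
      simp [ρ]
  · have key : ∀ i, c.toAddCon (ρ (A i 0, A i 1)) (ρ (B i 0, B i 1)) := fun i => by
      have : c.toAddCon (Matrix.single 0 i 1 * A) (Matrix.single 0 i 1 * B) :=
        c.smul (Matrix.single 0 i 1) h
      convert this using 1 <;> ext k j <;> fin_cases k <;> fin_cases j <;>
        simp [ρ]
    ext i j
    have := hpq _ _ (key i)
    fin_cases j
    · simpa [Matrix.mul_apply] using congrArg Prod.fst this
    · simpa [Matrix.mul_apply] using congrArg Prod.snd this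

theorem BooleanSemifield.isLeftCPSemiring_matrix {n : ℕ} (hn : n = 1 ∨ n = 2) :
    IsLeftCPSemiring (Matrix (Fin n) (Fin n) BooleanSemifield) := by
  obtain rfl | rfl := hn
  · exact isLeftCPSemiring.of_surjective
      (Matrix.uniqueRingEquiv (m := Fin 1)).symm.toRingHom (RingEquiv.surjective _)
  · exact isLeftCPSemiring_matrix_two

/-! ### The dichotomy for one factor, and the classification -/

/-- One invertible `a` with `a + b = 0` suffices: `a⁻¹ * b` serves as `-1`, so `D` is a division
ring. -/
theorem isArtinianSimpleRing_matrix {D : Type u} [Semiring D] [Nontrivial D]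
    (hu : ∀ a : D, a ≠ 0 → IsUnit a) {a b : D} (ha : a ≠ 0) (hab : a + b = 0) {n : ℕ}
    (hn : n ≠ 0) : IsArtinianSimpleRing (Matrix (Fin n) (Fin n) D) := by
  obtain ⟨v, rfl⟩ := hu a ha
  let _ : Neg D := ⟨fun x => ↑v⁻¹ * b * x⟩
  let _ : Ring D :=
    { ‹Semiring D› with
      zsmul := zsmulRec
      neg_add_cancel := fun x => by
        change ↑v⁻¹ * b * x + x = 0
        calc ↑v⁻¹ * b * x + x = ↑v⁻¹ * (↑v + b) * x := by
              rw [mul_add, Units.inv_mul, add_mul, one_mul, add_comm]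
          _ = 0 := by rw [hab, mul_zero, zero_mul] }
  let _ : DivisionRing D := .ofIsUnitOrEqZero fun a => (em (a = 0)).symm.imp_left (hu a)
  have : Nonempty (Fin n) := ⟨⟨0, Nat.pos_of_ne_zero hn⟩⟩
  exact ⟨Matrix (Fin n) (Fin n) D, inferInstance, inferInstance, inferInstance, ⟨.refl _⟩⟩

theorem IsLeftCPSemiring.isArtinianSimpleRing_or_boolean {D : Type u} [Semiring D] [Nontrivial D]
    (hu : ∀ a : D, a ≠ 0 → IsUnit a) {n : ℕ} (hn : n ≠ 0)
    (h : IsLeftCPSemiring (Matrix (Fin n) (Fin n) D)) :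
    IsArtinianSimpleRing (Matrix (Fin n) (Fin n) D) ∨
      ∃ k : ℕ, (k = 1 ∨ k = 2) ∧
        Nonempty (Matrix (Fin n) (Fin n) D ≃+* Matrix (Fin k) (Fin k) BooleanSemifield) := by
  by_cases hz : ∀ a b : D, a + b = 0 → a = 0
  · have : Nonempty (Fin n) := ⟨⟨0, Nat.pos_of_ne_zero hn⟩⟩
    have hone : ∀ d : D, d ≠ 0 → d = 1 := fun d hd => h.eq_one_of_ne_zero hz hu hd
    -- `1 + 1` is nonzero by zerosumfreeness, and `1` is the only nonzero element.
    have h11 : (1 : D) + 1 = 1 := hone _ fun h => one_ne_zero (hz _ _ h)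
    obtain ⟨e⟩ := BooleanSemifield.nonempty_ringEquiv zero_ne_one h11 hone
    refine .inr ⟨n, ?_, ⟨e.mapMatrix⟩⟩
    by_contra hn'
    have h1 : 1 < n := by omega
    have h2 : 2 < n := by omega
    exact not_isLeftCPSemiring_matrix_of_ne zero_ne_one hz h11
      (a := ⟨0, Nat.pos_of_ne_zero hn⟩) (b := ⟨1, h1⟩) (c := ⟨2, h2⟩) (by simp) (by simp)
      (by simp) h
  · push Not at hz
    obtain ⟨a, b, hab, ha⟩ := hz
    exact .inl (isArtinianSimpleRing_matrix hu ha hab hn)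

theorem IsProductOfMatrixDivisionSemiring.isProductOfArtinianSimpleOrBooleanMatrix
    {S : Type u} [Semiring S] (hS : IsProductOfMatrixDivisionSemiring S)
    (h : IsLeftCPSemiring S) : IsProductOfArtinianSimpleOrBooleanMatrix S := by
  obtain ⟨r, n, D, _, hn, _, hu, ⟨e⟩⟩ := hS
  refine ⟨r, fun c => Matrix (Fin (n c)) (Fin (n c)) (D c), inferInstance, fun c => ?_, ⟨e⟩⟩
  exact (h.of_surjective ((Pi.evalRingHom _ c).comp e.toRingHom)
    ((Function.surjective_eval c).comp e.surjective)).isArtinianSimpleRing_or_boolean (hu c) (hn c)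

theorem IsProductOfArtinianSimpleOrBooleanMatrix.isLeftCPSemiring {S : Type u} [Semiring S]
    (h : IsProductOfArtinianSimpleOrBooleanMatrix S) : IsLeftCPSemiring S := by
  obtain ⟨r, T, _, hT, ⟨e⟩⟩ := h
  refine IsLeftCPSemiring.of_surjective (IsLeftCPSemiring.pi fun i => ?_) e.symm.toRingHom
    e.symm.surjective
  obtain h | ⟨n, hn, ⟨f⟩⟩ := hT i
  · exact h.isLeftCPSemiring
  · exact (BooleanSemifield.isLeftCPSemiring_matrix hn).of_surjective f.symm.toRingHom
      f.symm.surjective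

theorem IsArtinianSimpleRing.op {T : Type u} [Semiring T] (h : IsArtinianSimpleRing T) :
    IsArtinianSimpleRing Tᵐᵒᵖ := by
  obtain ⟨R, _, _, _, ⟨e⟩⟩ := h
  have : IsSemisimpleRing Rᵐᵒᵖ := inferInstance
  exact ⟨Rᵐᵒᵖ, inferInstance, inferInstance, inferInstance, ⟨e.op⟩⟩

theorem IsProductOfArtinianSimpleOrBooleanMatrix.op {S : Type u} [Semiring S]
    (h : IsProductOfArtinianSimpleOrBooleanMatrix S) :
    IsProductOfArtinianSimpleOrBooleanMatrix Sᵐᵒᵖ := by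
  obtain ⟨r, T, _, hT, ⟨e⟩⟩ := h
  refine ⟨r, fun i => (T i)ᵐᵒᵖ, inferInstance, fun i => ?_,
    ⟨e.op.trans (RingEquiv.piMulOpposite _)⟩⟩
  obtain h | ⟨n, hn, ⟨f⟩⟩ := hT i
  · exact .inl h.op
  · exact .inr ⟨n, hn, ⟨f.op.trans (Matrix.transposeRingEquiv _ _).symm⟩⟩

theorem IsProductOfArtinianSimpleOrBooleanMatrix.of_op {S : Type u} [Semiring S]
    (h : IsProductOfArtinianSimpleOrBooleanMatrix Sᵐᵒᵖ) :
    IsProductOfArtinianSimpleOrBooleanMatrix S := by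
  obtain ⟨r, T, _, hT, ⟨e⟩⟩ := h.op
  exact ⟨r, T, _, hT, ⟨(RingEquiv.opOp S).trans e⟩⟩

theorem IsProductOfMatrixDivisionSemiring.op {S : Type u} [Semiring S]
    (h : IsProductOfMatrixDivisionSemiring S) : IsProductOfMatrixDivisionSemiring Sᵐᵒᵖ := by
  obtain ⟨r, n, D, _, hn, hD, hu, ⟨e⟩⟩ := h
  exact .of_op ⟨r, n, D, _, hn, hD, hu, ⟨(RingEquiv.opOp S).symm.trans e⟩⟩

theorem theorem4p4 (S : Type u) [Semiring S]
    (hS : IsRightSemisimpleSemiring S ∨ IsLeftSemisimpleSemiring S) :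
    (IsRightCPSemiring S ↔ IsProductOfArtinianSimpleOrBooleanMatrix S) ∧
    (IsLeftCPSemiring S ↔ IsProductOfArtinianSimpleOrBooleanMatrix S) := by
  have hS : IsProductOfMatrixDivisionSemiring S :=
    hS.elim (·.isProductOfMatrixDivisionSemiring) (·.isProductOfMatrixDivisionSemiring)
  refine ⟨?_, hS.isProductOfArtinianSimpleOrBooleanMatrix, (·.isLeftCPSemiring)⟩
  rw [isRightCPSemiring_iff_isLeftCPSemiring_op]
  exact ⟨fun h => .of_op (hS.op.isProductOfArtinianSimpleOrBooleanMatrix h),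
    fun h => h.op.isLeftCPSemiring⟩
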